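/- Let $\mathcal A$ be a unital $C^*$-algebra and let $\phi_1,\phi_2$ be states on $\mathcal A$. A *representation* of $\mathcal A$ on a Hilbert space $H$ is a unital $*$-homomorphism $\mathcal A\to\mathcal B(H)$; inner products are linear in the second variable. For a linear map $f$ between $C^*$-algebras, $\|f\|_{cb}=\sup_{n}\|f^{(n)}\|$, where $f^{(n)}$ applies $f$ to each entry of an $n\times n$ matrix. Define the Bures distance $$\beta(\phi_1,\phi_2)=\inf\|x_1-x_2\|,$$ where the infimum is over all Hilbert spaces $H$, representations $\pi$ of $\mathcal A$ on $H$ and $x_1,x_2\in H$ with $\phi_i(a)=\langle x_i,\pi(a)x_i\rangle$ for all $a\in\mathcal A$, $i=1,2$. Define the representation distance $$\gamma(\phi_1,\phi_2)=\inf\|\sigma_1-\sigma_2\|_{cb},$$ where the infimum is over all Hilbert spaces $H$, representations $\sigma_1,\sigma_2$ of $\mathcal A$ on $H$ and unit vectors $x\in H$ with $\phi_i(a)=\langle x,\sigma_i(a)x\rangle$ for all $a\in\mathcal A$, $i=1,2$. **Theorem.** Writing $\beta=\beta(\phi_1,\phi_2)$ and $\gamma=\gamma(\phi_1,\phi_2)$,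 $$\|\phi_1-\phi_2\|_{cb}\le\gamma\le 2\sqrt{\|\phi_1-\phi_2\|_{cb}} .$$ Moreover $\beta\le\sqrt2$ and $$\gamma\le\beta\sqrt{4-\beta^2}\le 2\beta\le 2\sqrt{\|\phi_1-\phi_2\|_{cb}} .$$ -/

import Mathlib

open scoped ENNReal ComplexOrder

universe u v

namespace RepresentationMetric

/-- The completely bounded norm `‖f‖_cb = sup_n ‖f⁽ⁿ⁾‖` of a linear map between C⋆-algebras, where
`f⁽ⁿ⁾ : Mₙ(A) → Mₙ(B)` applies `f` to each entry, and `Mₙ(A)`, `Mₙ(B)` carry their C⋆-norms.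
The value `∞` is allowed; it means that `f` is not completely bounded. -/
noncomputable def cbNorm {A : Type u} {B : Type v}
    [CStarAlgebra A] [PartialOrder A] [StarOrderedRing A]
    [CStarAlgebra B] [PartialOrder B] [StarOrderedRing B] (f : A →ₗ[ℂ] B) : ℝ≥0∞ :=
  ⨆ (n : ℕ) (M : CStarMatrix (Fin n) (Fin n) A) (_ : ‖M‖ ≤ 1), ‖M.map f‖ₑ

section States

variable {A : Type u} [CStarAlgebra A] [PartialOrder A] [StarOrderedRing A]

/-- The set `S(π, φ)` of all vectors `x ∈ H` with `φ(a) = ⟨x, π(a) x⟩` for all `a`. The inner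
product is linear in the second variable. -/
def representingVectors {H : Type u} [NormedAddCommGroup H] [InnerProductSpace ℂ H]
    [CompleteSpace H] (π : A →⋆ₐ[ℂ] (H →L[ℂ] H)) (φ : A →ₚ[ℂ] ℂ) : Set H :=
  {x | ∀ a : A, φ a = inner ℂ x (π a x)}

/-- `(H, σ₁, σ₂, x)` is a joint representation tuple of `(φ₁, φ₂)`: `σ₁, σ₂` are unital
representations of `A` on the same Hilbert space `H`, and the unit vector `x` implements
`φ₁` through `σ₁` and `φ₂` through `σ₂`. -/
structure IsJointRepresentation {H : Type u} [NormedAddCommGroup H] [InnerProductSpace ℂ H]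
    [CompleteSpace H] (φ₁ φ₂ : A →ₚ[ℂ] ℂ) (σ₁ σ₂ : A →⋆ₐ[ℂ] (H →L[ℂ] H)) (x : H) : Prop where
  norm_eq_one : ‖x‖ = 1
  left_mem : x ∈ representingVectors σ₁ φ₁
  right_mem : x ∈ representingVectors σ₂ φ₂

/-- The completely bounded distance `‖σ₁ - σ₂‖_cb` of two representations on the same space. -/
noncomputable def cbDist {H : Type u} [NormedAddCommGroup H] [InnerProductSpace ℂ H]
    [CompleteSpace H] (σ₁ σ₂ : A →⋆ₐ[ℂ] (H →L[ℂ] H)) : ℝ≥0∞ :=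
  cbNorm (σ₁.toAlgHom.toLinearMap - σ₂.toAlgHom.toLinearMap)

/-- The Bures distance `β(φ₁, φ₂)`: the infimum of `‖x₁ - x₂‖` over all unital representations
`π` of `A` on a Hilbert space `H` and all `x₁ ∈ S(π, φ₁)`, `x₂ ∈ S(π, φ₂)`.
Letting `H` range over the universe of `A` is no restriction, because one may always pass to
the closed invariant subspace generated by `x₁` and `x₂`. -/
noncomputable def buresDist (φ₁ φ₂ : A →ₚ[ℂ] ℂ) : ℝ≥0∞ :=
  ⨅ (H : Type u) (_ : NormedAddCommGroup H) (_ : InnerProductSpace ℂ H) (_ : CompleteSpace H)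
    (π : A →⋆ₐ[ℂ] (H →L[ℂ] H)) (x₁ ∈ representingVectors π φ₁) (x₂ ∈ representingVectors π φ₂),
    ‖x₁ - x₂‖ₑ

/-- The representation distance `γ(φ₁, φ₂)`: the infimum of `‖σ₁ - σ₂‖_cb` over all joint
representation tuples `(H, σ₁, σ₂, x)` of `(φ₁, φ₂)`.
Letting `H` range over the universe of `A` is no restriction, because one may always pass to
the closed subspace generated by `x` that is invariant under `σ₁` and `σ₂`. -/
noncomputable def repDist (φ₁ φ₂ : A →ₚ[ℂ] ℂ) : ℝ≥0∞ :=
  ⨅ (H : Type u) (_ : NormedAddCommGroup H) (_ : InnerProductSpace ℂ H) (_ : CompleteSpace H)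
    (σ₁ : A →⋆ₐ[ℂ] (H →L[ℂ] H)) (σ₂ : A →⋆ₐ[ℂ] (H →L[ℂ] H)) (x : H)
    (_ : IsJointRepresentation φ₁ φ₂ σ₁ σ₂ x), cbDist σ₁ σ₂

end States

end RepresentationMetric

/-! Lower bound: if one unit vector `x` implements both states, then `φ₁ - φ₂` is `σ₁ - σ₂` followed
by the vector functional of `x`, which is completely contractive (`norm_map_vectorState_le`).

`γ ≤ β√(4 - β²)`: given `x₁, x₂` for one `π`, adjust the phase so that `⟨x₁, x₂⟩ = r ≥ 0`. With `s =
√(1 - r²)` a unitary `U = r + i s S`, `S` a self-adjoint unitary, carries `x₁` to `x₂`. Then `x₁`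
implements `φ₂` through `U* π U`, and `π - U* π U = U* (i s [S, π])` has cb-norm at most `2s = d√(4
- d²)`, where `d² = ‖x₁ - x₂‖² = 2 - 2r`.

`β² ≤ ‖φ₁ - φ₂‖_cb`: vectors close together come from the GNS space of a positive functional on
`M₂(A)` with diagonal `φ₁, φ₂` and large off-diagonal entry at `1`. Riesz extension produces it; the
positivity this needs is dual to the inequality `2 - K ≤ φ₁(g) + φ₂(g⁻¹)`. -/

namespace RepresentationMetric

set_option linter.unusedSectionVars false

/-! ### Alberti-type inequality -/

section Alberti

variable {A : Type u} [CStarAlgebra A] [PartialOrder A] [StarOrderedRing A]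

/-- A special case of Alberti's inequality: if `φ₁, φ₂` are states at distance at most `K` on the
unit ball, then `2 - K ≤ φ₁(g) + φ₂(g⁻¹)` for every positive invertible `g`. -/
theorem two_sub_le_re_add_re_inv (φ₁ φ₂ : A →ₚ[ℂ] ℂ) (h₁ : φ₁ 1 = 1) (h₂ : φ₂ 1 = 1) {K : ℝ}
    (hK : ∀ a : A, ‖a‖ ≤ 1 → ‖φ₁ a - φ₂ a‖ ≤ K) (g : A) (hg : IsSelfAdjoint g)
    (hpos : ∀ x ∈ spectrum ℝ g, 0 < x) :
    2 - K ≤ (φ₁ g).re + (φ₂ (cfc (fun x : ℝ ↦ x⁻¹) g)).re := by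
  have hinv : ContinuousOn (fun x : ℝ ↦ x⁻¹) (spectrum ℝ g) :=
    continuousOn_inv₀.mono fun x hx ↦ (hpos x hx).ne'
  -- Any contraction with `1 - g⁻¹ ≤ h ≤ g - 1` would do: testing `φ₁ - φ₂` on it gives the bound.
  -- For `x > 0` the scalar function lies in `[-1, 1]` and between `1 - x⁻¹` and `x - 1`.
  set h : A := cfc (fun x : ℝ ↦ min (x - 1) 1) g with hdef
  have hnorm : ‖h‖ ≤ 1 := by
    refine norm_cfc_le zero_le_one fun x hx ↦ ?_
    have := hpos x hx
    rw [Real.norm_eq_abs, abs_le]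
    exact ⟨le_min (by linarith) (by norm_num), min_le_right _ _⟩
  have hle₁ : h ≤ g - 1 := by
    have e : g - 1 = cfc (fun x : ℝ ↦ x - 1) g := by
      rw [cfc_sub (fun x : ℝ ↦ x) (fun _ ↦ 1) g, cfc_id' ℝ g, cfc_const_one ℝ g]
    rw [e]
    exact cfc_mono fun x _ ↦ min_le_left _ _
  have hle₂ : 1 - cfc (fun x : ℝ ↦ x⁻¹) g ≤ h := by
    have e : 1 - cfc (fun x : ℝ ↦ x⁻¹) g = cfc (fun x : ℝ ↦ 1 - x⁻¹) g := by
      rw [cfc_sub (fun _ : ℝ ↦ 1) (fun x ↦ x⁻¹) g, cfc_const_one ℝ g]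
    rw [e]
    refine cfc_mono fun x hx ↦ ?_
    have hx0 := hpos x hx
    refine le_min ?_ (by have := inv_pos.mpr hx0; linarith)
    have : x - 1 - (1 - x⁻¹) = (x - 1) ^ 2 / x := by field_simp
    have h2 : 0 ≤ (x - 1) ^ 2 / x := by positivity
    linarith
  have e₁ : (φ₁ h).re ≤ (φ₁ g).re - 1 := by
    have := (Complex.le_def.mp (OrderHomClass.mono φ₁ hle₁)).1
    simpa [map_sub, h₁] using this
  have e₂ : 1 - (φ₂ (cfc (fun x : ℝ ↦ x⁻¹) g)).re ≤ (φ₂ h).re := by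
    have := (Complex.le_def.mp (OrderHomClass.mono φ₂ hle₂)).1
    simpa [map_sub, h₂] using this
  have e₃ := (Complex.abs_re_le_norm _).trans (hK h hnorm)
  rw [Complex.sub_re, abs_le] at e₃
  linarith [e₃.1]

end Alberti

/-! ### Positive two-by-two matrices with scalar off-diagonal -/

section TwoByTwo

variable {A : Type u} [CStarAlgebra A] [PartialOrder A] [StarOrderedRing A]

theorem exists_eq_star_mul_self (a : A) (ha : 0 ≤ a) : ∃ b, a = star b * b :=
  CStarAlgebra.nonneg_iff_eq_star_mul_self.mp ha

/-- Compression of a positive matrix by a column vector is positive. -/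
theorem sum_star_mul_mul_nonneg {n : Type*} [Fintype n] [DecidableEq n]
    {Y : CStarMatrix n n A} (hY : 0 ≤ Y) (v : n → A) :
    0 ≤ ∑ i, ∑ j, star (v i) * Y i j * v j := by
  obtain ⟨Z, rfl⟩ := exists_eq_star_mul_self Y hY
  have : ∑ i, ∑ j, star (v i) * (star Z * Z) i j * v j =
      ∑ k, star (∑ i, Z k i * v i) * ∑ j, Z k j * v j := by
    simp only [CStarMatrix.mul_apply, CStarMatrix.star_apply, star_sum, star_mul, Finset.sum_mul,
      Finset.mul_sum, mul_assoc]
    rw [Finset.sum_comm]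
    conv_lhs => enter [2, j]; rw [Finset.sum_comm]
    rw [Finset.sum_comm]
  rw [this]
  exact Finset.sum_nonneg fun k _ ↦ star_mul_self_nonneg _

theorem diag_nonneg {n : Type*} [Fintype n] [DecidableEq n]
    {Y : CStarMatrix n n A} (hY : 0 ≤ Y) (k : n) : 0 ≤ Y k k := by
  have := sum_star_mul_mul_nonneg hY (Pi.single k 1)
  rw [Finset.sum_eq_single k, Finset.sum_eq_single k] at this
  · simpa using this
  · intro j _ hj; simp [Pi.single_eq_of_ne hj]
  · simp
  · intro j _ hj; simp [Pi.single_eq_of_ne hj]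
  · simp

/-- A Schur complement bound: compressing `Y` by the column `(gi, 1)` gives `Y 1 1 ≥ s • gi + ε •
gi²`. -/
theorem inv_mul_smul_le {Y : CStarMatrix (Fin 2) (Fin 2) A} (hY : 0 ≤ Y) {s ε : ℝ}
    (hs : 0 < s) (hε : 0 < ε) (h01 : Y 0 1 = (-s) • (1 : A)) (h10 : Y 1 0 = (-s) • (1 : A))
    {g gi : A} (hg : g = s⁻¹ • (Y 0 0 + ε • (1 : A))) (hgi : IsSelfAdjoint gi)
    (hmul : gi * g = 1) : s • gi ≤ Y 1 1 := by
  have h := sum_star_mul_mul_nonneg hY ![gi, 1]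
  have hY0 : Y 0 0 = s • g - ε • (1 : A) := by
    rw [hg, smul_smul, mul_inv_cancel₀ hs.ne']; simp
  simp only [Fin.sum_univ_two, Matrix.cons_val_zero, Matrix.cons_val_one, hgi.star_eq, h01, h10,
    hY0, star_one, mul_one, one_mul, mul_sub, sub_mul, mul_smul_comm, smul_mul_assoc, hmul] at h
  have h2 : 0 ≤ ε • (gi * gi) := by
    refine smul_nonneg hε.le ?_
    simpa [hgi.star_eq] using star_mul_self_nonneg gi
  have : Y 1 1 - s • gi = (s • gi - ε • (gi * gi) + -s • gi + (-s • gi + Y 1 1)) + ε • (gi * gi) := by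
    simp only [neg_smul]; abel
  rw [← sub_nonneg, this]
  exact add_nonneg h h2

/-- The positivity hypothesis for the Riesz extension. Only `t = -s < 0` has content: apply the
Alberti inequality to `g = s⁻¹ (Y 0 0 + ε)`, where `ε` ensures invertibility, bound `s g⁻¹` by `Y 1
1`, and let `ε → 0`. -/
theorem re_add_re_add_nonneg (φ₁ φ₂ : A →ₚ[ℂ] ℂ) (h₁ : φ₁ 1 = 1) (h₂ : φ₂ 1 = 1) {K : ℝ}
    (hK2 : K ≤ 2)
    (hK : ∀ a : A, ‖a‖ ≤ 1 → ‖φ₁ a - φ₂ a‖ ≤ K) {Y : CStarMatrix (Fin 2) (Fin 2) A} (hY : 0 ≤ Y)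
    {t : ℝ} (h01 : Y 0 1 = t • (1 : A)) (h10 : Y 1 0 = t • (1 : A)) :
    0 ≤ (φ₁ (Y 0 0)).re + (φ₂ (Y 1 1)).re + (2 - K) * t := by
  have h0 := diag_nonneg hY 0
  rcases le_or_gt 0 t with ht | ht
  · have e₁ := (Complex.le_def.mp (φ₁.map_nonneg h0)).1
    have e₂ := (Complex.le_def.mp (φ₂.map_nonneg (diag_nonneg hY 1))).1
    have e₃ : 0 ≤ (2 - K) * t := mul_nonneg (by linarith) ht
    simp only [Complex.zero_re] at e₁ e₂
    linarith
  · obtain ⟨s, rfl⟩ : ∃ s, t = -s := ⟨-t, by simp⟩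
    have hs : 0 < s := by linarith
    refine le_of_forall_pos_le_add fun ε hε ↦ ?_
    set g : A := s⁻¹ • (Y 0 0 + ε • (1 : A)) with hg
    have hle : algebraMap ℝ A (s⁻¹ * ε) ≤ g := by
      rw [hg, Algebra.algebraMap_eq_smul_one, mul_smul]
      exact smul_le_smul_of_nonneg_left (le_add_of_nonneg_left h0) (by positivity)
    have hgsa : IsSelfAdjoint g :=
      .of_nonneg <| (algebraMap_nonneg A (by positivity : (0 : ℝ) ≤ s⁻¹ * ε)).trans hle
    have hpos : ∀ x ∈ spectrum ℝ g, 0 < x := fun x hx ↦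
      (by positivity : 0 < s⁻¹ * ε).trans_le
        ((algebraMap_le_iff_le_spectrum (a := g) hgsa).mp hle x hx)
    have hinv : ContinuousOn (fun x : ℝ ↦ x⁻¹) (spectrum ℝ g) :=
      continuousOn_inv₀.mono fun x hx ↦ (hpos x hx).ne'
    have hmul : cfc (fun x : ℝ ↦ x⁻¹) g * g = 1 := by
      nth_rewrite 2 [← cfc_id' ℝ g]
      rw [← cfc_mul (fun x : ℝ ↦ x⁻¹) (fun x ↦ x) g, ← cfc_one ℝ g]
      exact cfc_congr fun x hx ↦ inv_mul_cancel₀ (hpos x hx).ne'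
    have key := two_sub_le_re_add_re_inv φ₁ φ₂ h₁ h₂ hK g hgsa hpos
    have hle₂ := inv_mul_smul_le hY hs hε h01 h10 hg (cfc_predicate _ g) hmul
    have e₂ := (Complex.le_def.mp (OrderHomClass.mono φ₂ hle₂)).1
    have e₁ : (φ₁ g).re = s⁻¹ * ((φ₁ (Y 0 0)).re + ε) := by
      rw [hg, ← Complex.coe_smul, ← Complex.coe_smul, map_smul, map_add, map_smul, h₁]
      simp [-Complex.ofReal_inv]
    rw [← Complex.coe_smul, map_smul, smul_eq_mul, Complex.re_ofReal_mul] at e₂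
    have e₃ : s * (φ₁ g).re = (φ₁ (Y 0 0)).re + ε := by rw [e₁]; field_simp
    nlinarith [mul_le_mul_of_nonneg_left key hs.le]

end TwoByTwo

/-! ### Diagonal embedding into matrices -/

section DiagHom

variable {A : Type u} [CStarAlgebra A] [PartialOrder A] [StarOrderedRing A]

/-- The unital embedding `a ↦ diag(a, …, a)`. -/
noncomputable def diagHom (A : Type u) [CStarAlgebra A] [PartialOrder A] [StarOrderedRing A]
    (n : Type*) [Fintype n] [DecidableEq n] : A →⋆ₐ[ℂ] CStarMatrix n n A where
  toFun a := CStarMatrix.ofMatrix (Matrix.diagonal fun _ ↦ a)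
  map_one' := by ext i j; exact Matrix.diagonal_apply ..
  map_mul' a b := by
    ext i j; by_cases h : i = j <;>
      simp [Matrix.diagonal_apply, CStarMatrix.mul_apply, h]
  map_zero' := by ext i j; simp
  map_add' a b := by ext i j; by_cases h : i = j <;> simp [h]
  commutes' r := by ext i j; simp [Matrix.diagonal_apply, CStarMatrix.algebraMap_apply]
  map_star' a := by
    ext i j
    by_cases h : i = j
    · simp [CStarMatrix.star_apply, h]
    · simp [CStarMatrix.star_apply, h, Ne.symm h]

theorem diagHom_apply {n : Type*} [Fintype n] [DecidableEq n] (a : A) (i j : n) :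
    diagHom A n a i j = if i = j then a else 0 := Matrix.diagonal_apply ..

theorem diagHom_mul_apply {n : Type*} [Fintype n] [DecidableEq n] (a : A) (M : CStarMatrix n n A)
    (i j : n) : (diagHom A n a * M) i j = a * M i j := by
  simp [CStarMatrix.mul_apply, diagHom_apply]

theorem mul_diagHom_apply {n : Type*} [Fintype n] [DecidableEq n] (a : A) (M : CStarMatrix n n A)
    (i j : n) : (M * diagHom A n a) i j = M i j * a := by
  simp [CStarMatrix.mul_apply, diagHom_apply]

theorem norm_diagHom_le {n : Type*} [Fintype n] [DecidableEq n] (a : A) :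
    ‖diagHom A n a‖ ≤ ‖a‖ := NonUnitalStarAlgHom.norm_apply_le (diagHom A n) a

end DiagHom

/-! ### Extension of positive functionals -/

section Extension

variable {B : Type u} [CStarAlgebra B] [PartialOrder B] [StarOrderedRing B]

/-- The real cone of all elements whose real part is positive. -/
def realPartCone (B : Type u) [CStarAlgebra B] [PartialOrder B] [StarOrderedRing B] :
    PointedCone ℝ B where
  carrier := {x | 0 ≤ x + star x}
  add_mem' {x y} hx hy := by
    have := add_nonneg hx hy
    simp only [Set.mem_ofPred_eq, star_add]
    rwa [add_add_add_comm] at this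
  zero_mem' := by simp
  smul_mem' c x hx := by
    have h : c • x + star (c • x) = (c : ℝ) • (x + star x) := by
      change (c : ℝ) • x + star ((c : ℝ) • x) = _
      rw [star_smul, smul_add, star_trivial]
    simp only [Set.mem_ofPred_eq, h]
    exact smul_nonneg c.2 hx

theorem mem_realPartCone {x : B} : x ∈ realPartCone B ↔ 0 ≤ x + star x := Iff.rfl

/-- Riesz extension on a unital C⋆-algebra: a real-linear functional which is nonnegative on the
elements with positive real part of a real subspace containing `1` agrees there with the real part
of a positive linear functional. -/
theorem exists_positive_extension (F : B →ₗ[ℝ] ℝ) (D : Submodule ℝ B) (h1 : (1 : B) ∈ D)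
    (hF : ∀ x ∈ D, 0 ≤ x + star x → 0 ≤ F x) :
    ∃ Φ : B →ₚ[ℂ] ℂ, ∀ x ∈ D, (Φ x).re = F x := by
  obtain ⟨g, hgF, hg⟩ := riesz_extension (realPartCone B) ⟨D, F ∘ₗ D.subtype⟩
    (fun x hx ↦ hF x x.2 hx) fun y ↦ by
      -- `1` is an order unit, so a large multiple of it moves any `y` into the cone.
      refine ⟨⟨‖y + star y‖ • 1, D.smul_mem _ h1⟩, ?_⟩
      rw [mem_realPartCone]
      have hsa : IsSelfAdjoint (y + star y) := .add_star_self y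
      have h := hsa.neg_algebraMap_norm_le_self
      rw [Algebra.algebraMap_eq_smul_one, neg_le_iff_add_nonneg] at h
      have h' : (0 : B) ≤ ‖y + star y‖ • (1 : B) := smul_nonneg (norm_nonneg _) zero_le_one
      have e : ‖y + star y‖ • (1 : B) + y + star (‖y + star y‖ • (1 : B) + y) =
          ‖y + star y‖ • (1 : B) + (y + star y + ‖y + star y‖ • (1 : B)) := by
        simp only [star_add, star_smul, star_one, star_trivial]; abel
      change 0 ≤ ‖y + star y‖ • (1 : B) + y + star (‖y + star y‖ • (1 : B) + y)
      rw [e]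
      exact add_nonneg h' h
  -- Skew-adjoint elements lie in the cone together with their negatives. This makes the
  -- complexification of `g` real on self-adjoint elements.
  have hskew : ∀ x : B, x + star x = 0 → g x = 0 := fun x hx ↦ by
    refine le_antisymm ?_ (hg x (by simp [mem_realPartCone, hx]))
    have : 0 ≤ g (-x) := hg (-x) (by rw [mem_realPartCone, star_neg, ← neg_add, hx, neg_zero])
    simpa using this
  refine ⟨PositiveLinearMap.mk₀ (Module.Dual.extendRCLike (𝕜 := ℂ) g) fun x hx ↦ ?_, fun x hx ↦ ?_⟩
  · have hsa : star x = x := IsSelfAdjoint.of_nonneg hx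
    have e : g (Complex.I • x) = 0 := hskew _ (by simp [hsa])
    have e' : 0 ≤ g x := hg x (by rw [mem_realPartCone, hsa]; exact add_nonneg hx hx)
    rw [Module.Dual.extendRCLike_apply]
    change 0 ≤ (g x : ℂ) - Complex.I * (g (Complex.I • x) : ℂ)
    simpa [e] using e'
  · have := hgF ⟨x, hx⟩
    exact (Module.Dual.re_extendRCLike_apply (𝕜 := ℂ) g x).trans this

theorem re_apply_star (Φ : B →ₚ[ℂ] ℂ) (x : B) : (Φ (star x)).re = (Φ x).re := by
  rw [map_star]; simp

end Extension

/-! ### Bures distance via GNS on two-by-two matrices -/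

section Bures

variable {A : Type u} [CStarAlgebra A]

/-- The matrix with single nonzero entry `a` at `(i, j)`. -/
def entryMatrix (i j : Fin 2) (a : A) : CStarMatrix (Fin 2) (Fin 2) A :=
  CStarMatrix.ofMatrix (Matrix.single i j a)

theorem entryMatrix_apply (i j : Fin 2) (a : A) (k l : Fin 2) :
    entryMatrix i j a k l = if i = k ∧ j = l then a else 0 := Matrix.single_apply ..

variable [PartialOrder A] [StarOrderedRing A]

theorem star_entryMatrix_mul_diagHom_mul (i j k l : Fin 2) (a : A) :
    star (entryMatrix i j (1 : A)) * (diagHom A (Fin 2) a * entryMatrix k l 1) =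
      if i = k then entryMatrix j l a else 0 := by
  ext p q
  fin_cases i <;> fin_cases k <;> fin_cases j <;> fin_cases l <;> fin_cases p <;> fin_cases q <;>
    simp [CStarMatrix.mul_apply, CStarMatrix.star_apply, diagHom_apply, entryMatrix_apply]

/-- Two states at distance at most `K ≤ 2` are the diagonal of a positive functional on the
two-by-two matrices whose off-diagonal entry has real part `1 - K / 2` at `1`. -/
theorem exists_positive_matrix_functional (φ₁ φ₂ : A →ₚ[ℂ] ℂ) (h₁ : φ₁ 1 = 1) (h₂ : φ₂ 1 = 1)
    {K : ℝ} (hK2 : K ≤ 2) (hK : ∀ a : A, ‖a‖ ≤ 1 → ‖φ₁ a - φ₂ a‖ ≤ K) :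
    ∃ Φ : CStarMatrix (Fin 2) (Fin 2) A →ₚ[ℂ] ℂ,
      (∀ a, Φ (entryMatrix 0 0 a) = φ₁ a) ∧ (∀ a, Φ (entryMatrix 1 1 a) = φ₂ a) ∧
      (Φ (entryMatrix 0 1 1)).re = 1 - K / 2 := by
  -- On `D` the two off-diagonal entries agree, so the weight `2 - K` is shared by both corners;
  -- each gets real part `1 - K / 2` at `1`.
  let F : CStarMatrix (Fin 2) (Fin 2) A →ₗ[ℝ] ℝ :=
    { toFun := fun X ↦ (φ₁ (X 0 0)).re + (φ₂ (X 1 1)).re + (2 - K) * (φ₁ (X 0 1)).re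
      map_add' := fun X Y ↦ by simp; ring
      map_smul' := fun c X ↦ by
        simp only [CStarMatrix.smul_apply, ← Complex.coe_smul, map_smul]
        simp; ring }
  let D : Submodule ℝ (CStarMatrix (Fin 2) (Fin 2) A) :=
    { carrier := {X | ∃ t : ℝ, X 0 1 = t • (1 : A) ∧ X 1 0 = t • (1 : A)}
      add_mem' := by
        rintro X Y ⟨t, ht, ht'⟩ ⟨s, hs, hs'⟩
        exact ⟨t + s, by simp [ht, hs, add_smul], by simp [ht', hs', add_smul]⟩
      zero_mem' := ⟨0, by simp⟩
      smul_mem' := by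
        rintro c X ⟨t, ht, ht'⟩
        exact ⟨c * t, by simp [ht, mul_smul], by simp [ht', mul_smul]⟩ }
  have hφ (φ : A →ₚ[ℂ] ℂ) (a : A) : (φ (star a)).re = (φ a).re := re_apply_star φ a
  obtain ⟨Φ, hΦF⟩ := exists_positive_extension F D ⟨0, by simp⟩ (by
    rintro X ⟨t, ht, ht'⟩ hX
    have h := re_add_re_add_nonneg φ₁ φ₂ h₁ h₂ hK2 hK hX (t := 2 * t)
      (by simp [CStarMatrix.star_apply, ht, ht', two_mul, add_smul])
      (by simp [CStarMatrix.star_apply, ht, ht', two_mul, add_smul])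
    simp only [CStarMatrix.add_apply, CStarMatrix.star_apply, map_add, Complex.add_re, hφ] at h
    have e : (φ₁ (X 0 1)).re = t := by
      rw [ht, ← Complex.coe_smul, map_smul, h₁]; simp
    change 0 ≤ (φ₁ (X 0 0)).re + (φ₂ (X 1 1)).re + (2 - K) * (φ₁ (X 0 1)).re
    rw [e]
    linarith)
  have hΦ (X : CStarMatrix (Fin 2) (Fin 2) A) (hX : X ∈ D) :
      (Φ X).re = (φ₁ (X 0 0)).re + (φ₂ (X 1 1)).re + (2 - K) * (φ₁ (X 0 1)).re := hΦF X hX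
  have hsmul (i : Fin 2) (a : A) :
      entryMatrix i i (Complex.I • a) = Complex.I • entryMatrix i i a := by
    ext k l; by_cases h : i = k ∧ i = l <;> simp [entryMatrix_apply, h]
  have hmem (i : Fin 2) (a : A) : entryMatrix i i a ∈ D := by
    refine ⟨0, ?_, ?_⟩ <;> fin_cases i <;> simp [entryMatrix_apply]
  have hre₁ (a : A) : (Φ (entryMatrix 0 0 a)).re = (φ₁ a).re := by
    rw [hΦ _ (hmem 0 a)]
    simp [entryMatrix_apply]
  have hre₂ (a : A) : (Φ (entryMatrix 1 1 a)).re = (φ₂ a).re := by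
    rw [hΦ _ (hmem 1 a)]
    simp [entryMatrix_apply]
  -- Real parts suffice: applying them to `I • a` recovers the imaginary parts.
  refine ⟨Φ, fun a ↦ Complex.ext (hre₁ a) ?_, fun a ↦ Complex.ext (hre₂ a) ?_, ?_⟩
  · have := hre₁ (Complex.I • a)
    rw [hsmul, map_smul, map_smul] at this
    simpa using this
  · have := hre₂ (Complex.I • a)
    rw [hsmul, map_smul, map_smul] at this
    simpa using this
  · have e : star (entryMatrix 0 1 (1 : A)) = entryMatrix 1 0 1 := by
      ext p q
      fin_cases p <;> fin_cases q <;> simp [CStarMatrix.star_apply, entryMatrix_apply]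
    have h := hΦ (entryMatrix 0 1 1 + entryMatrix 1 0 1) ⟨1, by simp [entryMatrix_apply]⟩
    rw [map_add, Complex.add_re, ← e, re_apply_star, e] at h
    simp [entryMatrix_apply, h₁] at h
    linarith

theorem buresDist_le {H : Type u} [NormedAddCommGroup H] [InnerProductSpace ℂ H] [CompleteSpace H]
    {φ₁ φ₂ : A →ₚ[ℂ] ℂ} {π : A →⋆ₐ[ℂ] (H →L[ℂ] H)} {x₁ x₂ : H}
    (hx₁ : x₁ ∈ representingVectors π φ₁) (hx₂ : x₂ ∈ representingVectors π φ₂) :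
    buresDist φ₁ φ₂ ≤ ‖x₁ - x₂‖ₑ :=
  iInf_le_of_le H <| iInf_le_of_le _ <| iInf_le_of_le _ <| iInf_le_of_le inferInstance <|
    iInf_le_of_le π <| iInf₂_le_of_le x₁ hx₁ <| iInf₂_le x₂ hx₂

theorem buresDist_sq_le (φ₁ φ₂ : A →ₚ[ℂ] ℂ) (h₁ : φ₁ 1 = 1) (h₂ : φ₂ 1 = 1)
    {K : ℝ} (hK2 : K ≤ 2) (hK : ∀ a : A, ‖a‖ ≤ 1 → ‖φ₁ a - φ₂ a‖ ≤ K) :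
    buresDist φ₁ φ₂ ^ 2 ≤ ENNReal.ofReal K := by
  obtain ⟨Φ, hΦ₁, hΦ₂, hΦ⟩ := exists_positive_matrix_functional φ₁ φ₂ h₁ h₂ hK2 hK
  let π : A →⋆ₐ[ℂ] (Φ.GNS →L[ℂ] Φ.GNS) := Φ.gnsStarAlgHom.comp (diagHom A (Fin 2))
  -- First-row matrix units satisfy `E₀ᵢ* E₀ⱼ = Eᵢⱼ`, so inner products of these vectors read off
  -- the entries of `Φ`.
  let x (j : Fin 2) : Φ.GNS := (Φ.toPreGNS (entryMatrix 0 j 1) : Φ.PreGNS)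
  have hx (i j : Fin 2) (a : A) : inner ℂ (x i) (π a (x j)) = Φ (entryMatrix i j a) := by
    have : π a (x j) =
        (Φ.toPreGNS (diagHom A (Fin 2) a * entryMatrix 0 j 1) : Φ.PreGNS) := by
      simp [π, x]
    rw [this, UniformSpace.Completion.inner_coe, PositiveLinearMap.preGNS_inner_def]
    simp only [PositiveLinearMap.ofPreGNS_toPreGNS]
    rw [star_entryMatrix_mul_diagHom_mul, if_pos rfl]
  have hx1 (i j : Fin 2) : inner ℂ (x i) (x j) = Φ (entryMatrix i j 1) := by
    simpa using hx i j 1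
  have m₁ : x 0 ∈ representingVectors π φ₁ := fun a ↦ by rw [hx, hΦ₁]
  have m₂ : x 1 ∈ representingVectors π φ₂ := fun a ↦ by rw [hx, hΦ₂]
  have hle : buresDist φ₁ φ₂ ≤ ‖x 0 - x 1‖ₑ := buresDist_le m₁ m₂
  have hnorm : ‖x 0 - x 1‖ ^ 2 = K := by
    have n₀ : ‖x 0‖ ^ 2 = 1 := by
      rw [← inner_self_eq_norm_sq (𝕜 := ℂ), hx1, hΦ₁, h₁]; simp
    have n₁ : ‖x 1‖ ^ 2 = 1 := by
      rw [← inner_self_eq_norm_sq (𝕜 := ℂ), hx1, hΦ₂, h₂]; simp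
    rw [@norm_sub_sq ℂ, n₀, n₁, hx1]
    change 1 - 2 * (Φ (entryMatrix 0 1 1)).re + 1 = K
    rw [hΦ]; ring
  calc buresDist φ₁ φ₂ ^ 2 ≤ ‖x 0 - x 1‖ₑ ^ 2 := by gcongr
    _ = ENNReal.ofReal K := by
      rw [← ofReal_norm, ← ENNReal.ofReal_pow (norm_nonneg _), hnorm]

end Bures

/-! ### Lower bound by compression to a vector -/

section Compression

variable {H : Type u} [NormedAddCommGroup H] [InnerProductSpace ℂ H] [CompleteSpace H]

/-- The vector state of a unit vector is completely contractive. -/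
theorem norm_map_vectorState_le {n : Type*} [Fintype n] [DecidableEq n] {x : H} (hx : ‖x‖ = 1)
    (N : CStarMatrix n n (H →L[ℂ] H)) :
    ‖N.map (fun T ↦ (inner ℂ x (T x) : ℂ))‖ ≤ ‖N‖ := by
  let P : H →L[ℂ] H := (ℂ ∙ x).starProjection
  have hP (v : H) : P v = inner ℂ x v • x := Submodule.starProjection_unit_singleton ℂ hx v
  have hPP : P * P = P := Submodule.isIdempotentElem_starProjection _
  have hPs : star P = P := isSelfAdjoint_starProjection _
  have hx0 : x ≠ 0 := by rintro rfl; simp at hx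
  -- Identifies `ℂ` with the corner `P B(H) P`. Injective star homomorphisms are isometric, so the
  -- scalar matrix has the norm of the compression of `N` by `diag(P, …, P)`.
  let ι : ℂ →⋆ₙₐ[ℂ] (H →L[ℂ] H) :=
    { toFun := fun t ↦ t • P
      map_smul' := fun c t ↦ by simp [mul_smul]
      map_zero' := by simp
      map_add' := fun s t ↦ add_smul ..
      map_mul' := fun s t ↦ by rw [smul_mul_smul_comm, hPP]
      map_star' := fun t ↦ by rw [star_smul, hPs] }
  have hι : Function.Injective ι := fun s t h ↦ by
    have := congrArg (fun T : H →L[ℂ] H ↦ T x) h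
    change s • P x = t • P x at this
    simpa [hP, hx, hx0] using this
  have hinj : Function.Injective (CStarMatrix.mapₙₐ (n := n) ι) := fun M N h ↦ by
    ext i j
    exact hι (congrFun (congrFun h i) j)
  have hcomp : CStarMatrix.mapₙₐ ι (N.map (fun T ↦ (inner ℂ x (T x) : ℂ))) =
      diagHom _ n P * N * diagHom _ n P := by
    ext i j : 1
    rw [mul_diagHom_apply, diagHom_mul_apply]
    ext v
    change inner ℂ x (N i j x) • P v = P (N i j (P v))
    simp only [hP, map_smul, smul_smul, inner_smul_right]
    rw [mul_comm]
  have hPn : ‖diagHom (H →L[ℂ] H) n P‖ ≤ 1 :=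
    (norm_diagHom_le P).trans (Submodule.starProjection_norm_le _)
  rw [← NonUnitalStarAlgHom.norm_map _ hinj, hcomp]
  calc _ ≤ ‖diagHom (H →L[ℂ] H) n P‖ * ‖N‖ * ‖diagHom (H →L[ℂ] H) n P‖ := norm_mul₃_le
    _ ≤ 1 * ‖N‖ * 1 := by gcongr
    _ = ‖N‖ := by ring

variable {A : Type u} [CStarAlgebra A] [PartialOrder A] [StarOrderedRing A]

theorem cbNorm_sub_le_cbDist {φ₁ φ₂ : A →ₚ[ℂ] ℂ} {σ₁ σ₂ : A →⋆ₐ[ℂ] (H →L[ℂ] H)} {x : H}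
    (h : IsJointRepresentation φ₁ φ₂ σ₁ σ₂ x) :
    cbNorm (φ₁.toLinearMap - φ₂.toLinearMap) ≤ cbDist σ₁ σ₂ := by
  refine iSup_mono fun n ↦ iSup₂_mono fun M _ ↦ ?_
  have e : M.map (φ₁.toLinearMap - φ₂.toLinearMap) =
      (M.map (σ₁.toAlgHom.toLinearMap - σ₂.toAlgHom.toLinearMap)).map
        (fun T ↦ (inner ℂ x (T x) : ℂ)) := by
    ext i j
    change φ₁ (M i j) - φ₂ (M i j) = inner ℂ x ((σ₁ (M i j) - σ₂ (M i j)) x)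
    rw [sub_apply, inner_sub_right, h.left_mem, h.right_mem]
  rw [e, ← ofReal_norm, ← ofReal_norm]
  exact ENNReal.ofReal_le_ofReal (norm_map_vectorState_le h.norm_eq_one _)

theorem repDist_le_cbDist {φ₁ φ₂ : A →ₚ[ℂ] ℂ} {σ₁ σ₂ : A →⋆ₐ[ℂ] (H →L[ℂ] H)} {x : H}
    (h : IsJointRepresentation φ₁ φ₂ σ₁ σ₂ x) : repDist φ₁ φ₂ ≤ cbDist σ₁ σ₂ :=
  iInf_le_of_le H <| iInf_le_of_le _ <| iInf_le_of_le _ <| iInf_le_of_le inferInstance <|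
    iInf_le_of_le σ₁ <| iInf_le_of_le σ₂ <| iInf_le_of_le x <| iInf_le _ h

theorem cbNorm_sub_le_repDist (φ₁ φ₂ : A →ₚ[ℂ] ℂ) :
    cbNorm (φ₁.toLinearMap - φ₂.toLinearMap) ≤ repDist φ₁ φ₂ :=
  le_iInf fun _ ↦ le_iInf fun _ ↦ le_iInf fun _ ↦ le_iInf fun _ ↦ le_iInf fun _ ↦
    le_iInf fun _ ↦ le_iInf fun _ ↦ le_iInf fun h ↦ cbNorm_sub_le_cbDist h

end Compression

/-! ### Rotating one vector to the other -/

section Rotation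

variable {H : Type u} [NormedAddCommGroup H] [InnerProductSpace ℂ H] [CompleteSpace H]

/-- A reflection exchanging two orthogonal unit vectors. -/
theorem exists_reflection {v w : H} (hv : ‖v‖ = 1) (hw : ‖w‖ = 1) (hvw : inner ℂ v w = (0 : ℂ)) :
    ∃ S : H →L[ℂ] H, star S = S ∧ S * S = 1 ∧ S v = w := by
  let P : H →L[ℂ] H := (ℂ ∙ (v - w)).starProjection
  have hPP : P * P = P := Submodule.isIdempotentElem_starProjection _
  have hPs : star P = P := isSelfAdjoint_starProjection _
  -- Reflection in the hyperplane orthogonal to `v - w`; orthogonality gives `P v = (v - w) / 2`.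
  refine ⟨1 - 2 * P, ?_, ?_, ?_⟩
  · rw [star_sub, star_mul, hPs, star_one, star_ofNat]
    exact congrArg _ (Commute.ofNat_right P 2)
  · have : (1 - 2 * P) * (1 - 2 * P) = 1 - 4 * P + 4 * (P * P) := by noncomm_ring
    rw [this, hPP]; simp
  · have hu : ‖v - w‖ ^ 2 = 2 := by
      rw [@norm_sub_sq ℂ, hv, hw, hvw]; norm_num
    have hwv : inner ℂ w v = (0 : ℂ) := inner_eq_zero_symm.mp hvw
    have hPv : P v = (2 : ℂ)⁻¹ • (v - w) := by
      change (ℂ ∙ (v - w)).starProjection v = _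
      rw [Submodule.starProjection_singleton, inner_sub_left, hwv, inner_self_eq_norm_sq_to_K, hv]
      have : ((‖v - w‖ : ℝ) : ℂ) ^ 2 = 2 := by exact_mod_cast congrArg (fun r : ℝ ↦ (r : ℂ)) hu
      simp [this]
    have : (1 - 2 * P) v = v - (2 : ℂ) • P v := by
      rw [two_mul, two_smul]; rfl
    rw [this, hPv, smul_smul]
    simp

/-- Unit vectors with real inner product `r` are related by a unitary of the form `r + i s S`, where
`S` is a self-adjoint unitary and `s = √(1 - r²)`. -/
theorem exists_unitary_smul_add {x₁ x₂ : H} (h₁ : ‖x₁‖ = 1) (h₂ : ‖x₂‖ = 1) {r s : ℝ}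
    (hr : inner ℂ x₁ x₂ = (r : ℂ)) (hs : 0 ≤ s) (hrs : r ^ 2 + s ^ 2 = 1) :
    ∃ S : H →L[ℂ] H, star S = S ∧ S * S = 1 ∧
      (r : ℂ) • x₁ + (Complex.I * s) • S x₁ = x₂ := by
  have hn : ‖x₂ - (r : ℂ) • x₁‖ ^ 2 = s ^ 2 := by
    have hr' : inner ℂ x₂ x₁ = (r : ℂ) := by rw [← inner_conj_symm, hr]; simp
    rw [@norm_sub_sq ℂ, inner_smul_right, hr', norm_smul, h₁, h₂]
    simp
    nlinarith
  rcases hs.eq_or_lt with rfl | hs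
  · refine ⟨1, star_one _, mul_one _, ?_⟩
    have : x₂ - (r : ℂ) • x₁ = 0 := by simpa using hn
    simpa using (sub_eq_zero.mp this).symm
  · have hn' : ‖x₂ - (r : ℂ) • x₁‖ = s := by
      rwa [sq_eq_sq₀ (norm_nonneg _) hs.le] at hn
    have hsC : (s : ℂ) ≠ 0 := by exact_mod_cast hs.ne'
    have hIs : Complex.I * s ≠ 0 := mul_ne_zero Complex.I_ne_zero hsC
    -- `w` is the component of `x₂` orthogonal to `x₁`, normalised by its length `s`. Dividing also
    -- by `i` is what lets a self-adjoint `S` give a unitary `r + i s S`.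
    obtain ⟨S, hS, hSS, hSx⟩ := exists_reflection (v := x₁)
      (w := (Complex.I * s)⁻¹ • (x₂ - (r : ℂ) • x₁)) h₁
      (by rw [norm_smul, hn']; simp [abs_of_pos hs, hs.ne'])
      (by rw [inner_smul_right, inner_sub_right, inner_smul_right, hr,
            inner_self_eq_norm_sq_to_K, h₁]; simp)
    refine ⟨S, hS, hSS, ?_⟩
    rw [hSx, smul_smul, mul_inv_cancel₀ hIs]
    simp

theorem norm_le_one_of_star_mul_self {B : Type*} [CStarAlgebra B] {U : B} (h : star U * U = 1) :
    ‖U‖ ≤ 1 := by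
  nontriviality B
  have := CStarRing.norm_star_mul_self (x := U)
  rw [h, norm_one] at this
  nlinarith [norm_nonneg U]

variable {A : Type u} [CStarAlgebra A] [PartialOrder A] [StarOrderedRing A]

/-- Conjugation by `U = r + i s S` moves a representation by at most `2 s` in cb-norm. -/
theorem cbDist_conj_le (π : A →⋆ₐ[ℂ] (H →L[ℂ] H)) {S : H →L[ℂ] H} (hS : star S = S)
    (hSS : S * S = 1) {r s : ℝ} (hs : 0 ≤ s) (U : unitary (H →L[ℂ] H))
    (hU : (U : H →L[ℂ] H) = (r : ℂ) • 1 + (Complex.I * s) • S) :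
    cbDist π ((Unitary.conjStarAlgAut ℂ (H →L[ℂ] H) (star U) :
      (H →L[ℂ] H) →⋆ₐ[ℂ] (H →L[ℂ] H)).comp π) ≤ ENNReal.ofReal (2 * s) := by
  refine iSup_le fun n ↦ iSup₂_le fun M hM ↦ ?_
  let π' : A →⋆ₙₐ[ℂ] (H →L[ℂ] H) := π
  set M' : CStarMatrix (Fin n) (Fin n) (H →L[ℂ] H) := CStarMatrix.mapₙₐ π' M
  have hM' : ‖M'‖ ≤ 1 :=
    (NonUnitalStarAlgHom.norm_apply_le (CStarMatrix.mapₙₐ (n := Fin n) π') M).trans hM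
  let dg := diagHom (H →L[ℂ] H) (Fin n)
  have hd₁ : ‖dg S‖ ≤ 1 :=
    (norm_diagHom_le S).trans (norm_le_one_of_star_mul_self (by rw [hS, hSS]))
  have hd₂ : ‖dg (star U : unitary (H →L[ℂ] H))‖ ≤ 1 :=
    (norm_diagHom_le _).trans (norm_le_one_of_star_mul_self (Unitary.coe_star_mul_self _))
  rw [← ofReal_norm]
  refine ENNReal.ofReal_le_ofReal ?_
  -- The scalar part of `U` commutes with `T`, so only the commutator with `S` survives, with factor
  -- `s`.
  have key (T : H →L[ℂ] H) : T - (star (U : H →L[ℂ] H)) * T * U =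
      star (U : H →L[ℂ] H) * ((Complex.I * s) • (S * T - T * S)) := by
    have e : (Complex.I * s) • (S * T - T * S) = (U : H →L[ℂ] H) * T - T * U := by
      rw [hU, add_mul, mul_add, smul_mul_assoc, smul_mul_assoc, mul_smul_comm, mul_smul_comm,
        one_mul, mul_one, smul_sub]
      abel
    rw [e, mul_sub, ← mul_assoc, Unitary.coe_star_mul_self, one_mul, mul_assoc]
  have e : M.map (π.toAlgHom.toLinearMap -
      ((Unitary.conjStarAlgAut ℂ (H →L[ℂ] H) (star U) :
        (H →L[ℂ] H) →⋆ₐ[ℂ] (H →L[ℂ] H)).comp π).toAlgHom.toLinearMap) =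
      dg (star U : unitary (H →L[ℂ] H)) *
        ((Complex.I * s) • (dg S * M' - M' * dg S)) := by
    ext i j : 1
    rw [diagHom_mul_apply, CStarMatrix.smul_apply, CStarMatrix.sub_apply, diagHom_mul_apply,
      mul_diagHom_apply]
    refine Eq.trans ?_ (key (π (M i j)))
    change π (M i j) - Unitary.conjStarAlgAut ℂ (H →L[ℂ] H) (star U) (π (M i j)) = _
    rw [Unitary.conjStarAlgAut_star_apply]
  rw [e]
  calc _ ≤ ‖dg (star U : unitary (H →L[ℂ] H))‖ *
        (‖Complex.I * s‖ * (‖dg S‖ * ‖M'‖ + ‖M'‖ * ‖dg S‖)) := by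
        refine (norm_mul_le _ _).trans ?_
        rw [norm_smul]
        gcongr
        exact (norm_sub_le _ _).trans (add_le_add (norm_mul_le _ _) (norm_mul_le _ _))
    _ ≤ 1 * (s * (1 * 1 + 1 * 1)) := by
        gcongr
        simp [abs_of_nonneg hs]
    _ = 2 * s := by ring

theorem norm_eq_one_of_mem {φ : A →ₚ[ℂ] ℂ} (h : φ 1 = 1) {π : A →⋆ₐ[ℂ] (H →L[ℂ] H)} {x : H}
    (hx : x ∈ representingVectors π φ) : ‖x‖ = 1 := by
  have := hx 1
  rw [h, map_one, one_apply_eq_self, inner_self_eq_norm_sq_to_K] at this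
  have h' : ((‖x‖ ^ 2 : ℝ) : ℂ) = (1 : ℝ) := by simpa using this.symm
  rw [← pow_eq_one_iff_of_nonneg (norm_nonneg x) two_ne_zero]
  exact Complex.ofReal_injective h'

theorem repDist_le_of_inner_eq {φ₁ φ₂ : A →ₚ[ℂ] ℂ} (h₁ : φ₁ 1 = 1) (h₂ : φ₂ 1 = 1)
    {π : A →⋆ₐ[ℂ] (H →L[ℂ] H)} {x₁ x₂ : H} (hx₁ : x₁ ∈ representingVectors π φ₁)
    (hx₂ : x₂ ∈ representingVectors π φ₂) {r s : ℝ}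
    (hr : inner ℂ x₁ x₂ = (r : ℂ)) (hs : 0 ≤ s) (hrs : r ^ 2 + s ^ 2 = 1) :
    repDist φ₁ φ₂ ≤ ENNReal.ofReal (2 * s) := by
  obtain ⟨S, hS, hSS, hSx⟩ := exists_unitary_smul_add (norm_eq_one_of_mem h₁ hx₁)
    (norm_eq_one_of_mem h₂ hx₂) hr hs hrs
  have hrs' : (r : ℂ) * r - Complex.I * s * (Complex.I * s) = 1 := by
    have : (r : ℂ) ^ 2 + (s : ℂ) ^ 2 = 1 := by exact_mod_cast hrs
    linear_combination this - s ^ 2 * Complex.I_sq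
  have hVU : star ((r : ℂ) • 1 + (Complex.I * s) • S : H →L[ℂ] H) =
      (r : ℂ) • 1 - (Complex.I * s) • S := by
    rw [star_add, star_smul, star_smul, hS, star_one]
    simp [sub_eq_add_neg]
  let U : unitary (H →L[ℂ] H) := ⟨(r : ℂ) • 1 + (Complex.I * s) • S, by
    rw [Unitary.mem_iff, hVU]
    constructor <;>
    · simp only [sub_mul, mul_sub, add_mul, mul_add, smul_mul_smul_comm, hSS, mul_one, one_mul]
      conv_rhs => rw [← one_smul ℂ (1 : H →L[ℂ] H), ← hrs']
      module⟩
  have hUx : (U : H →L[ℂ] H) x₁ = x₂ := hSx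
  refine (repDist_le_cbDist ⟨norm_eq_one_of_mem h₁ hx₁, hx₁, fun a ↦ ?_⟩).trans
    (cbDist_conj_le π hS hSS hs U rfl)
  change φ₂ a = inner ℂ x₁ (Unitary.conjStarAlgAut ℂ (H →L[ℂ] H) (star U) (π a) x₁)
  rw [Unitary.conjStarAlgAut_star_apply, hx₂ a]
  change _ = inner ℂ x₁ (star (U : H →L[ℂ] H) (π a ((U : H →L[ℂ] H) x₁)))
  rw [ContinuousLinearMap.star_eq_adjoint, ContinuousLinearMap.adjoint_inner_right, hUx]

end Rotation

/-! ### Assembling the estimates -/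

section Main

variable {A : Type u} [CStarAlgebra A] [PartialOrder A] [StarOrderedRing A]

theorem norm_apply_le_of_map_one (φ : A →ₚ[ℂ] ℂ) (h : φ 1 = 1) (a : A) : ‖φ a‖ ≤ ‖a‖ := by
  let x : φ.GNS := (φ.toPreGNS 1 : φ.PreGNS)
  have hx (b : A) : inner ℂ x (φ.gnsStarAlgHom b x) = φ b := by
    have : φ.gnsStarAlgHom b x = (φ.toPreGNS (b * 1) : φ.PreGNS) := by simp [x]
    rw [this, UniformSpace.Completion.inner_coe, PositiveLinearMap.preGNS_inner_def]
    simp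
  have hx1 : ‖x‖ ^ 2 = 1 := by
    have := hx 1
    rw [map_one, one_apply_eq_self, h] at this
    rw [← inner_self_eq_norm_sq (𝕜 := ℂ), this]; simp
  rw [← hx a]
  calc _ ≤ ‖x‖ * (‖φ.gnsStarAlgHom a‖ * ‖x‖) :=
        (norm_inner_le_norm _ _).trans (by gcongr; exact ContinuousLinearMap.le_opNorm _ _)
    _ = ‖φ.gnsStarAlgHom a‖ * ‖x‖ ^ 2 := by ring
    _ ≤ ‖a‖ := by
      rw [hx1, mul_one]; exact NonUnitalStarAlgHom.norm_apply_le φ.gnsStarAlgHom a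

theorem enorm_apply_le_cbNorm {B : Type v} [CStarAlgebra B] [PartialOrder B] [StarOrderedRing B]
    (f : A →ₗ[ℂ] B) {a : A} (ha : ‖a‖ ≤ 1) : ‖f a‖ₑ ≤ cbNorm f := by
  refine le_trans ?_ (le_iSup_of_le 1 <| le_iSup₂_of_le (diagHom A (Fin 1) a)
    ((norm_diagHom_le a).trans ha) le_rfl)
  rw [← ofReal_norm, ← ofReal_norm]
  refine ENNReal.ofReal_le_ofReal ?_
  have := CStarMatrix.norm_entry_le_norm (M := (diagHom A (Fin 1) a).map f) (i := 0) (j := 0)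
  simpa [diagHom_apply] using this

theorem buresDist_sq_le_two (φ₁ φ₂ : A →ₚ[ℂ] ℂ) (h₁ : φ₁ 1 = 1) (h₂ : φ₂ 1 = 1) :
    buresDist φ₁ φ₂ ^ 2 ≤ 2 := by
  have := buresDist_sq_le φ₁ φ₂ h₁ h₂ le_rfl fun a ha ↦ (norm_sub_le _ _).trans <| by
    linarith [norm_apply_le_of_map_one φ₁ h₁ a, norm_apply_le_of_map_one φ₂ h₂ a]
  simpa using this

/-- The Bures distance is bounded by the square root of the cb-distance of the states. -/
theorem buresDist_sq_le_cbNorm (φ₁ φ₂ : A →ₚ[ℂ] ℂ) (h₁ : φ₁ 1 = 1) (h₂ : φ₂ 1 = 1) :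
    buresDist φ₁ φ₂ ^ 2 ≤ cbNorm (φ₁.toLinearMap - φ₂.toLinearMap) := by
  -- The matrix functional needs `K ≤ 2`; beyond that the bound `β² ≤ 2` already suffices.
  rcases le_total 2 (cbNorm (φ₁.toLinearMap - φ₂.toLinearMap)) with h | h
  · exact (buresDist_sq_le_two φ₁ φ₂ h₁ h₂).trans h
  · have htop : cbNorm (φ₁.toLinearMap - φ₂.toLinearMap) ≠ ⊤ := (h.trans_lt (by simp)).ne
    have := buresDist_sq_le φ₁ φ₂ h₁ h₂
      (K := (cbNorm (φ₁.toLinearMap - φ₂.toLinearMap)).toReal)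
      (by simpa using ENNReal.toReal_mono (by simp) h)
      (fun a ha ↦ by
        have := ENNReal.toReal_mono htop
          (enorm_apply_le_cbNorm (φ₁.toLinearMap - φ₂.toLinearMap) ha)
        simpa using this)
    rwa [ENNReal.ofReal_toReal htop] at this

/-- The phase-adjusted distance `d` satisfies `β ≤ d ≤ ‖x₁ - x₂‖`. Using the upper bound in the
factor `d` and the lower one in `√(4 - d²)` avoids any monotonicity of `d√(4 - d²)`. -/
theorem repDist_le_enorm_mul (φ₁ φ₂ : A →ₚ[ℂ] ℂ) (h₁ : φ₁ 1 = 1) (h₂ : φ₂ 1 = 1)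
    {H : Type u} [NormedAddCommGroup H] [InnerProductSpace ℂ H] [CompleteSpace H]
    {π : A →⋆ₐ[ℂ] (H →L[ℂ] H)} {x₁ x₂ : H} (hx₁ : x₁ ∈ representingVectors π φ₁)
    (hx₂ : x₂ ∈ representingVectors π φ₂) :
    repDist φ₁ φ₂ ≤ ‖x₁ - x₂‖ₑ * (4 - buresDist φ₁ φ₂ ^ 2) ^ (1 / 2 : ℝ) := by
  obtain ⟨ζ, hζ, hζr⟩ : ∃ ζ : ℂ, ‖ζ‖ = 1 ∧ ζ * inner ℂ x₁ x₂ = (‖(inner ℂ x₁ x₂ : ℂ)‖ : ℂ) := by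
    rcases eq_or_ne (inner ℂ x₁ x₂ : ℂ) 0 with h | h
    · exact ⟨1, by simp, by simp [h]⟩
    · exact ⟨‖(inner ℂ x₁ x₂ : ℂ)‖ / inner ℂ x₁ x₂, by simp [h], div_mul_cancel₀ _ h⟩
  set r : ℝ := ‖(inner ℂ x₁ x₂ : ℂ)‖ with hr
  have hn₁ := norm_eq_one_of_mem h₁ hx₁
  have hn₂ := norm_eq_one_of_mem h₂ hx₂
  have hr1 : r ≤ 1 := by
    simpa [hn₁, hn₂] using norm_inner_le_norm (𝕜 := ℂ) x₁ x₂
  have hr0 : 0 ≤ r := norm_nonneg _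
  have hinner : inner ℂ x₁ (ζ • x₂) = (r : ℂ) := by rw [inner_smul_right, hζr]
  have hy : ζ • x₂ ∈ representingVectors π φ₂ := fun a ↦ by
    have : (starRingEnd ℂ) ζ * ζ = 1 := by
      rw [← Complex.normSq_eq_conj_mul_self, Complex.normSq_eq_norm_sq, hζ]; simp
    rw [map_smul, inner_smul_left, inner_smul_right, ← mul_assoc, this, one_mul, hx₂ a]
  have hd' : ‖x₁ - ζ • x₂‖ ^ 2 = 2 - 2 * r := by
    rw [@norm_sub_sq ℂ, hinner, norm_smul, hζ, hn₁, hn₂]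
    simp; ring
  have hd : ‖x₁ - ζ • x₂‖ ≤ ‖x₁ - x₂‖ := by
    rw [← sq_le_sq₀ (norm_nonneg _) (norm_nonneg _), hd', @norm_sub_sq ℂ, hn₁, hn₂]
    have := (Complex.re_le_norm (inner ℂ x₁ x₂ : ℂ))
    change _ ≤ 1 ^ 2 - 2 * (inner ℂ x₁ x₂ : ℂ).re + 1 ^ 2
    linarith
  have hβ : buresDist φ₁ φ₂ ≤ ‖x₁ - ζ • x₂‖ₑ := buresDist_le hx₁ hy
  have key := repDist_le_of_inner_eq h₁ h₂ hx₁ hy hinner (Real.sqrt_nonneg (1 - r ^ 2))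
    (by rw [Real.sq_sqrt (by nlinarith)]; ring)
  have e : 2 * √(1 - r ^ 2) = ‖x₁ - ζ • x₂‖ * (4 - ‖x₁ - ζ • x₂‖ ^ 2) ^ (1 / 2 : ℝ) := by
    rw [← Real.sqrt_eq_rpow, ← sq_eq_sq₀ (by positivity) (by positivity), mul_pow, mul_pow,
      Real.sq_sqrt (by nlinarith), Real.sq_sqrt (by rw [hd']; linarith), hd']
    ring
  calc repDist φ₁ φ₂ ≤ ENNReal.ofReal (2 * √(1 - r ^ 2)) := key
    _ = ‖x₁ - ζ • x₂‖ₑ * (4 - ‖x₁ - ζ • x₂‖ₑ ^ 2) ^ (1 / 2 : ℝ) := by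
      rw [e, ENNReal.ofReal_mul (norm_nonneg _), ofReal_norm,
        ← ENNReal.ofReal_rpow_of_nonneg (by rw [hd']; linarith) (by norm_num),
        ENNReal.ofReal_sub _ (by positivity), ENNReal.ofReal_pow (norm_nonneg _), ofReal_norm]
      simp
    _ ≤ ‖x₁ - x₂‖ₑ * (4 - buresDist φ₁ φ₂ ^ 2) ^ (1 / 2 : ℝ) := by
      gcongr
      exact enorm_le_iff_norm_le.mpr hd

theorem repDist_le_buresDist_mul (φ₁ φ₂ : A →ₚ[ℂ] ℂ) (h₁ : φ₁ 1 = 1) (h₂ : φ₂ 1 = 1) :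
    repDist φ₁ φ₂ ≤ buresDist φ₁ φ₂ * (4 - buresDist φ₁ φ₂ ^ 2) ^ (1 / 2 : ℝ) := by
  set k := (4 - buresDist φ₁ φ₂ ^ 2) ^ (1 / 2 : ℝ) with hk
  have hβ := buresDist_sq_le_two φ₁ φ₂ h₁ h₂
  -- The factor `k` does not depend on the vectors and is nonzero since `β² ≤ 2 < 4`; dividing by it
  -- lets the infimum be taken in the other factor.
  have hk0 : k ≠ 0 := by
    have h4 : 4 - buresDist φ₁ φ₂ ^ 2 ≠ 0 :=
      (tsub_pos_of_lt (hβ.trans_lt (by norm_num))).ne'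
    simp [hk, h4]
  have hk1 : k ≠ ⊤ := ENNReal.rpow_ne_top_of_nonneg (by norm_num) (by finiteness)
  rw [← ENNReal.div_le_iff hk0 hk1]
  refine le_iInf fun H ↦ le_iInf fun _ ↦ le_iInf fun _ ↦ le_iInf fun _ ↦ le_iInf fun π ↦
    le_iInf₂ fun x₁ hx₁ ↦ le_iInf₂ fun x₂ hx₂ ↦ ?_
  rw [ENNReal.div_le_iff hk0 hk1]
  exact repDist_le_enorm_mul φ₁ φ₂ h₁ h₂ hx₁ hx₂

end Main

end RepresentationMetric

theorem mainTheorem6 {A : Type u} [CStarAlgebra A] [PartialOrder A] [StarOrderedRing A]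
    (φ₁ φ₂ : A →ₚ[ℂ] ℂ) (h₁ : φ₁ 1 = 1) (h₂ : φ₂ 1 = 1) :
    (RepresentationMetric.cbNorm (φ₁.toLinearMap - φ₂.toLinearMap)
        ≤ RepresentationMetric.repDist φ₁ φ₂ ∧
      RepresentationMetric.repDist φ₁ φ₂
        ≤ 2 * RepresentationMetric.cbNorm (φ₁.toLinearMap - φ₂.toLinearMap) ^ (1 / 2 : ℝ)) ∧
    (RepresentationMetric.buresDist φ₁ φ₂ ^ 2 ≤ 2 ∧
      RepresentationMetric.repDist φ₁ φ₂
        ≤ RepresentationMetric.buresDist φ₁ φ₂ *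
          (4 - RepresentationMetric.buresDist φ₁ φ₂ ^ 2) ^ (1 / 2 : ℝ) ∧
      RepresentationMetric.buresDist φ₁ φ₂ *
          (4 - RepresentationMetric.buresDist φ₁ φ₂ ^ 2) ^ (1 / 2 : ℝ)
        ≤ 2 * RepresentationMetric.buresDist φ₁ φ₂ ∧
      2 * RepresentationMetric.buresDist φ₁ φ₂
        ≤ 2 * RepresentationMetric.cbNorm (φ₁.toLinearMap - φ₂.toLinearMap) ^ (1 / 2 : ℝ)) := by
  have hrep := RepresentationMetric.repDist_le_buresDist_mul φ₁ φ₂ h₁ h₂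
  have hmid : RepresentationMetric.buresDist φ₁ φ₂ *
      (4 - RepresentationMetric.buresDist φ₁ φ₂ ^ 2) ^ (1 / 2 : ℝ)
        ≤ 2 * RepresentationMetric.buresDist φ₁ φ₂ := by
    rw [mul_comm]
    gcongr
    calc (4 - RepresentationMetric.buresDist φ₁ φ₂ ^ 2) ^ (1 / 2 : ℝ)
        ≤ (2 ^ (2 : ℝ) : ℝ≥0∞) ^ (1 / 2 : ℝ) := by
          gcongr
          exact tsub_le_self.trans (by norm_num)
      _ = 2 := by rw [← ENNReal.rpow_mul]; norm_num
  have hlast : 2 * RepresentationMetric.buresDist φ₁ φ₂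
      ≤ 2 * RepresentationMetric.cbNorm (φ₁.toLinearMap - φ₂.toLinearMap) ^ (1 / 2 : ℝ) := by
    gcongr
    calc RepresentationMetric.buresDist φ₁ φ₂
        = (RepresentationMetric.buresDist φ₁ φ₂ ^ 2) ^ (1 / 2 : ℝ) := by
          rw [← ENNReal.rpow_natCast, ← ENNReal.rpow_mul]; norm_num
      _ ≤ _ := by
          gcongr
          exact RepresentationMetric.buresDist_sq_le_cbNorm φ₁ φ₂ h₁ h₂
  exact ⟨⟨RepresentationMetric.cbNorm_sub_le_repDist φ₁ φ₂, hrep.trans (hmid.trans hlast)⟩,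
    RepresentationMetric.buresDist_sq_le_two φ₁ φ₂ h₁ h₂, hrep, hmid, hlast⟩
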